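/- For a finite simple graph $G$ and a non-negative integer $x$, let $P(G,x)$ denote the number of proper colorings of $G$ with $x$ colors, that is, the value at $x$ of the chromatic polynomial of $G$; let $(y)_m = y(y-1)\cdots(y-m+1)$ be the falling factorial, and for $n > k \ge 4$ let $G_{n,k}$ be the graph on $n$ vertices obtained from the complete graph $K_k$ by adding a path with $n-k$ internal vertices (each of degree $2$) that joins two distinct vertices of $K_k$. A graph is 2-connected if it has at least three vertices, is connected, and remains connected after the deletion of any one vertex. **Theorem.** Let $n > k \ge 4$ be integers and let $G$ be a 2-connected graph with $n$ vertices, chromatic number $\chi(G) = k$ and clique number $\omega(G) = k$. Then for every integer $x \ge k$, $$P(G,x) \le (x-1)_{k-1}\big((x-1)^{n-k+1} + (-1)^{n-k}\big),$$ and, for each such $x$, equality holds if and only if $G \cong G_{n,k}$. -/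

import Mathlib

namespace SimpleGraph

/-- A graph is `2`-connected if it has at least three vertices, is connected, and remains
connected after the deletion of any single vertex. -/
structure IsTwoConnected {V : Type*} (G : SimpleGraph V) : Prop where
  three_le_card : 3 ≤ ENat.card V
  connected : G.Connected
  connected_deleteVert : ∀ v : V, (G.induce {v}ᶜ).Connected

/-- `P(G, x)` for `x : ℕ`: the number of proper colorings of `G` with the `x` colors
`0, …, x - 1`; this is the value at `x` of the chromatic polynomial of `G`. -/
noncomputable def numColorings {V : Type*} (G : SimpleGraph V) (x : ℕ) : ℕ :=
  Nat.card (G.Coloring (Fin x))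

/-- The graph `G_{n,k}` (for `n > k ≥ 2`) on the vertices `0, …, n - 1`: the vertices
`0, …, k - 1` form a clique, and the path `k - 1, k, k + 1, …, n - 1, 0` is an ear with the
`n - k` internal vertices `k, …, n - 1`, attached at the clique vertices `k - 1` and `0`. -/
def cliqueWithEar (n k : ℕ) : SimpleGraph (Fin n) :=
  SimpleGraph.fromRel fun u v : Fin n =>
    (u.val < k ∧ v.val < k) ∨
    (k - 1 ≤ u.val ∧ u.val + 1 = v.val) ∨
    (u.val + 1 = n ∧ v.val = 0)

end SimpleGraph

/-!
The vertex set is fixed, and graphs with isolated vertices are compared on it; an isolated vertex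
contributes a factor `x` to the number of colorings. Let `K` be a maximum clique, `C` the number of
colorings of the complete graph on `K`, `y = x - 1`, and let `p a = (y ^ a - (-1) ^ a) / (y + 1)`
be the number of ways to color the interior of a path with `a` edges whose ends have given distinct
colors (`pathColorings`); there are `p a + (-1) ^ a` ways if the ends have the same color.

As `G` is `2`-connected, it contains a spanning subgraph built from `K` by successively attaching
open ears with at least one internal vertex (`IsTwoConnected.exists_isEar`). One ear with `m`
internal vertices gives exactly `C * p (m + 1)` colorings
(`IsEar.pow_mul_numColorings_completeOn_sup`), and for `m = n - k` this is the bound. With two or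
more ears covering the same `M` vertices there are at most `C * (p (M + 1) - 1)` colorings
(`IsDeficient`). A further ear with `b` internal vertices multiplies the count by at most
`p (b + 1) + 1`, and `p (a + b) = y ^ b * p a + (-1) ^ a * p b` gives the needed inequalities
between the `p a`. They fail only for a second ear with one internal vertex attached after a first ear with
an odd number of edges; then the ends of the second ear have distinct colors in at least `2 * C`
colorings (`IsEar.two_mul_le_numColorings_sup_edge`), which lowers the count enough.

So equality forces a spanning subgraph consisting of `K` and one ear. It is all of `G`, since two
nonadjacent vertices of it get the same color in some coloring
(`IsEar.exists_mem_properColorings_eq`), so that an additional edge would lose colorings.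
-/

open Finset

namespace SimpleGraph

/-! ### Counting colorings one vertex at a time -/

section Counting

variable {V : Type*}

/-- The graph obtained from `H` by deleting all edges that meet `T`; the vertices of `T` stay as
isolated vertices. -/
def avoid (H : SimpleGraph V) (T : Finset V) : SimpleGraph V where
  Adj a b := H.Adj a b ∧ a ∉ T ∧ b ∉ T
  symm := ⟨fun _ _ h => ⟨h.1.symm, h.2.2, h.2.1⟩⟩
  loopless := ⟨fun _ h => h.1.ne rfl⟩

theorem avoid_adj {H : SimpleGraph V} {T : Finset V} {a b : V} :
    (H.avoid T).Adj a b ↔ H.Adj a b ∧ a ∉ T ∧ b ∉ T := Iff.rfl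

/-- The complete graph on the vertex set `K`, all other vertices being isolated. -/
def completeOn (K : Finset V) : SimpleGraph V where
  Adj a b := a ∈ K ∧ b ∈ K ∧ a ≠ b
  symm := ⟨fun _ _ h => ⟨h.2.1, h.1, h.2.2.symm⟩⟩
  loopless := ⟨fun _ h => h.2.2 rfl⟩

theorem completeOn_adj {K : Finset V} {a b : V} :
    (completeOn K).Adj a b ↔ a ∈ K ∧ b ∈ K ∧ a ≠ b := Iff.rfl

/-- If a set `A` of functions is closed under recoloring `u`, then recoloring `u` by a color from a
list `R c` which does not depend on the color of `u` can be counted by double counting: exchanging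
the color of `u` with a spare color is an involution. -/
theorem mul_card_filter_mem [DecidableEq V] {x : ℕ} (A : Finset (V → Fin x)) (u : V)
    (hA : ∀ c ∈ A, ∀ i, Function.update c u i ∈ A) (R : (V → Fin x) → Finset (Fin x))
    (hR : ∀ c i, R (Function.update c u i) = R c) :
    x * #(A.filter fun c => c u ∈ R c) = ∑ c ∈ A, #(R c) := by
  rw [← card_sigma, mul_comm]
  have hx : #(A.filter fun c => c u ∈ R c) * x
      = #((A.filter fun c => c u ∈ R c) ×ˢ (univ : Finset (Fin x))) := by
    rw [card_product, card_univ, Fintype.card_fin]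
  rw [hx]
  refine card_nbij' (fun a => ⟨Function.update a.1 u a.2, a.1 u⟩)
    (fun a => (Function.update a.1 u a.2, a.1 u)) ?_ ?_ ?_ ?_
  · rintro ⟨c, i⟩ h
    simp only [coe_product, Set.mem_prod, mem_coe, mem_filter] at h
    simpa [hR] using ⟨hA c h.1.1 i, h.1.2⟩
  · rintro ⟨c, i⟩ h
    simp only [coe_sigma, Set.mem_sigma_iff, mem_coe] at h
    simpa [hR] using ⟨hA c h.1 i, h.2⟩
  · rintro ⟨c, i⟩ h
    simp
  · rintro ⟨c, i⟩ h
    simp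

variable [Fintype V]

open Classical in
/-- The proper colorings of `H` with colors in `Fin x`, as a finset of functions. -/
noncomputable def properColorings (H : SimpleGraph V) (x : ℕ) : Finset (V → Fin x) :=
  univ.filter fun c => ∀ v w, H.Adj v w → c v ≠ c w

theorem mem_properColorings {H : SimpleGraph V} {x : ℕ} {c : V → Fin x} :
    c ∈ H.properColorings x ↔ ∀ v w, H.Adj v w → c v ≠ c w := by
  simp [properColorings]

theorem numColorings_eq_card (H : SimpleGraph V) (x : ℕ) :
    H.numColorings x = #(H.properColorings x) := by
  rw [numColorings, ← Nat.card_eq_finsetCard]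
  exact Nat.card_congr
    { toFun := fun c => ⟨c, mem_properColorings.2 fun v w h => c.valid h⟩
      invFun := fun c => Coloring.mk c.1 fun {v w} h => mem_properColorings.1 c.2 v w h
      left_inv := fun c => rfl
      right_inv := fun c => rfl }

/-- The number of proper colorings of `H` with `x` colors that give `s` and `t` the same color. -/
noncomputable def numColoringsSame (H : SimpleGraph V) (s t : V) (x : ℕ) : ℕ :=
  #((H.properColorings x).filter fun c => c s = c t)

theorem numColorings_anti {H H' : SimpleGraph V} (h : H ≤ H') (x : ℕ) :
    H'.numColorings x ≤ H.numColorings x := by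
  rw [numColorings_eq_card, numColorings_eq_card]
  exact card_le_card fun c hc => mem_properColorings.2 fun v w hvw =>
    mem_properColorings.1 hc v w (h hvw)

theorem update_mem_properColorings [DecidableEq V] {H : SimpleGraph V} {x : ℕ} {u : V}
    (hu : ∀ v, ¬ H.Adj u v) {c : V → Fin x} (hc : c ∈ H.properColorings x) (i : Fin x) :
    Function.update c u i ∈ H.properColorings x := by
  rw [mem_properColorings] at hc ⊢
  intro v w h
  have hv : v ≠ u := by rintro rfl; exact hu _ h
  have hw : w ≠ u := by rintro rfl; exact hu _ h.symm
  simpa [Function.update_of_ne hv, Function.update_of_ne hw] using hc v w h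

theorem mul_numColoringsSame_of_isolated {H : SimpleGraph V} {u w : V}
    (hu : ∀ v, ¬ H.Adj u v) (hw : w ≠ u) (x : ℕ) :
    x * H.numColoringsSame u w x = H.numColorings x := by
  classical
  have := mul_card_filter_mem (H.properColorings x) u
    (fun c hc i => update_mem_properColorings hu hc i) (fun c => {c w})
    (fun c i => by simp [Function.update_of_ne hw])
  simp only [mem_singleton, card_singleton, sum_const, smul_eq_mul, mul_one] at this
  rw [numColorings_eq_card, ← this, numColoringsSame]

theorem mem_properColorings_sup_edge {H : SimpleGraph V} {x : ℕ} {s t : V} (hst : s ≠ t)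
    {c : V → Fin x} :
    c ∈ (H ⊔ edge s t).properColorings x ↔ c ∈ H.properColorings x ∧ c s ≠ c t := by
  simp only [mem_properColorings, sup_adj, edge_adj]
  constructor
  · intro h
    exact ⟨fun v w hvw => h v w (Or.inl hvw), h s t (Or.inr ⟨Or.inl ⟨rfl, rfl⟩, hst⟩)⟩
  · rintro ⟨h, h'⟩ v w (hvw | ⟨⟨rfl, rfl⟩ | ⟨rfl, rfl⟩, -⟩)
    · exact h v w hvw
    · exact h'
    · exact h'.symm

theorem numColorings_sup_edge (H : SimpleGraph V) {s t : V} (hst : s ≠ t) (x : ℕ) :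
    (H ⊔ edge s t).numColorings x + H.numColoringsSame s t x = H.numColorings x := by
  rw [numColorings_eq_card, numColorings_eq_card, numColoringsSame, add_comm,
    ← card_filter_add_card_filter_not (s := H.properColorings x) (fun c => c s = c t)]
  congr 2
  ext c
  rw [mem_properColorings_sup_edge hst, mem_filter]

theorem numColoringsSame_le (H : SimpleGraph V) (s t : V) (x : ℕ) :
    H.numColoringsSame s t x ≤ H.numColorings x := by
  rw [numColorings_eq_card]
  exact card_filter_le _ _

theorem numColoringsSame_of_adj {H : SimpleGraph V} {s t : V} (h : H.Adj s t) (x : ℕ) :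
    H.numColoringsSame s t x = 0 := by
  rw [numColoringsSame, card_eq_zero, filter_eq_empty_iff]
  exact fun c hc => mem_properColorings.1 hc s t h

theorem mul_numColorings_sup_edge_of_isolated {H : SimpleGraph V} {s u : V}
    (hu : ∀ v, ¬ H.Adj u v) (hs : s ≠ u) (x : ℕ) :
    (x : ℤ) * (H ⊔ edge s u).numColorings x = ((x : ℤ) - 1) * H.numColorings x := by
  have h1 := numColorings_sup_edge H hs.symm x
  have h2 := mul_numColoringsSame_of_isolated hu hs x
  rw [edge_comm] at h1
  zify at h1 h2
  linear_combination (x : ℤ) * h1 - h2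

/-- Among the colorings of `H` with a pendant edge `su` added, those giving `u` and `t` the same
color correspond to colorings of `H` distinguishing `s` and `t`. -/
theorem mul_numColoringsSame_sup_edge_of_isolated {H : SimpleGraph V} {s t u : V}
    (hu : ∀ v, ¬ H.Adj u v) (hs : s ≠ u) (ht : t ≠ u) (hst : s ≠ t) (x : ℕ) :
    x * (H ⊔ edge s u).numColoringsSame u t x = (H ⊔ edge s t).numColorings x := by
  have hu' : ∀ v, ¬ (H ⊔ edge s t).Adj u v := by
    intro v
    simp only [sup_adj, edge_adj, not_or]
    exact ⟨hu v, by rintro ⟨⟨h, -⟩ | ⟨h, -⟩, -⟩ <;> [exact hs h.symm; exact ht h.symm]⟩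
  rw [← mul_numColoringsSame_of_isolated hu' ht x, numColoringsSame, numColoringsSame]
  congr 2
  ext c
  simp only [mem_filter, mem_properColorings_sup_edge hst, mem_properColorings_sup_edge hs]
  constructor
  · rintro ⟨⟨h1, h2⟩, h3⟩
    exact ⟨⟨h1, h3 ▸ h2⟩, h3⟩
  · rintro ⟨⟨h1, h2⟩, h3⟩
    exact ⟨⟨h1, h3 ▸ h2⟩, h3⟩

/-- A vertex whose neighbors lie in `N` can be colored in at least `x - #N` ways. -/
theorem numColorings_avoid_singleton_le {H : SimpleGraph V} {w : V} {N : Finset V}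
    (hN : ∀ v, H.Adj w v → v ∈ N) (x : ℕ) :
    (x - #N) * (H.avoid {w}).numColorings x ≤ x * H.numColorings x := by
  classical
  have hiso : ∀ v, ¬ (H.avoid {w}).Adj w v := fun v h => h.2.1 (mem_singleton_self w)
  have key := mul_card_filter_mem ((H.avoid {w}).properColorings x) w
    (fun c hc i => update_mem_properColorings hiso hc i) (fun c => ((N.erase w).image c)ᶜ) (by
      intro c i
      congr 1
      refine image_congr fun v hv => ?_
      rw [Function.update_of_ne (ne_of_mem_erase (mem_coe.1 hv))])
  have hsub : ((H.avoid {w}).properColorings x).filter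
      (fun c => c w ∈ ((N.erase w).image c)ᶜ) ⊆ H.properColorings x := by
    intro c hc
    rw [mem_filter, mem_properColorings] at hc
    simp only [mem_compl, mem_image, not_exists, not_and, mem_erase] at hc
    rw [mem_properColorings]
    intro a b hab
    by_cases ha : a = w
    · subst ha
      exact fun h => hc.2 b ⟨hab.ne', hN b hab⟩ h.symm
    by_cases hb : b = w
    · subst hb
      exact hc.2 a ⟨hab.ne, hN a hab.symm⟩
    · exact hc.1 a b ⟨hab, by simpa using ha, by simpa using hb⟩
  rw [numColorings_eq_card, numColorings_eq_card]
  calc (x - #N) * #((H.avoid {w}).properColorings x)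
      = ∑ c ∈ (H.avoid {w}).properColorings x, (x - #N) := by
        rw [sum_const, smul_eq_mul, mul_comm]
    _ ≤ ∑ c ∈ (H.avoid {w}).properColorings x, #((N.erase w).image c)ᶜ := by
        refine sum_le_sum fun c _ => ?_
        rw [card_compl, Fintype.card_fin]
        exact Nat.sub_le_sub_left (card_image_le.trans (card_erase_le)) x
    _ ≤ _ := by
        rw [← key]
        exact Nat.mul_le_mul_left x (card_le_card hsub)

theorem numColorings_avoid_le {H : SimpleGraph V} {d : ℕ} (x : ℕ) (T : Finset V)
    (hT : ∀ w ∈ T, ∃ N : Finset V, #N ≤ d ∧ ∀ v, H.Adj w v → v ∈ N) :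
    (x - d) ^ #T * (H.avoid T).numColorings x ≤ x ^ #T * H.numColorings x := by
  classical
  induction T using Finset.induction_on with
  | empty =>
    have : H.avoid ∅ = H := by ext a b; simp [avoid_adj]
    simp [this]
  | insert w T hw ih =>
    have ih := ih fun v hv => hT v (mem_insert_of_mem hv)
    obtain ⟨N, hNd, hN⟩ := hT w (mem_insert_self w T)
    have h1 := numColorings_avoid_singleton_le (H := H.avoid T) (w := w) (N := N)
      (fun v hv => hN v hv.1) x
    have h2 : (H.avoid T).avoid {w} = H.avoid (insert w T) := by
      ext a b
      simp only [avoid_adj, mem_insert, mem_singleton]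
      tauto
    rw [h2] at h1
    rw [card_insert_of_notMem hw, pow_succ, pow_succ]
    calc (x - d) ^ #T * (x - d) * (H.avoid (insert w T)).numColorings x
        ≤ (x - d) ^ #T * ((x - #N) * (H.avoid (insert w T)).numColorings x) := by
          rw [mul_assoc]
          gcongr
      _ ≤ (x - d) ^ #T * (x * (H.avoid T).numColorings x) := by gcongr
      _ = x * ((x - d) ^ #T * (H.avoid T).numColorings x) := by ring
      _ ≤ x * (x ^ #T * H.numColorings x) := by gcongr
      _ = _ := by ring

/-- Greedy coloring: a coloring that is proper outside `T` extends to `T`, if every vertex of `T`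
has fewer than `x` neighbors. -/
theorem exists_properColoring_extending {H : SimpleGraph V} {x : ℕ} (T : Finset V)
    (hT : ∀ w ∈ T, ∃ N : Finset V, #N < x ∧ ∀ v, H.Adj w v → v ∈ N) (c₀ : V → Fin x)
    (hc₀ : ∀ a b, a ∉ T → b ∉ T → H.Adj a b → c₀ a ≠ c₀ b) :
    ∃ c ∈ H.properColorings x, ∀ v ∉ T, c v = c₀ v := by
  classical
  induction T using Finset.induction_on generalizing c₀ with
  | empty =>
    exact ⟨c₀, mem_properColorings.2 fun a b => hc₀ a b (by simp) (by simp), fun v _ => rfl⟩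
  | insert w T hw ih =>
    obtain ⟨N, hNx, hN⟩ := hT w (mem_insert_self w T)
    obtain ⟨i, hi⟩ : ∃ i, i ∉ N.image c₀ := by
      by_contra! h
      have : #(univ : Finset (Fin x)) ≤ #N := (card_le_card fun i _ => h i).trans card_image_le
      rw [card_univ, Fintype.card_fin] at this
      omega
    have hi' : ∀ v ∈ N, c₀ v ≠ i := fun v hv h => hi (mem_image.2 ⟨v, hv, h⟩)
    obtain ⟨c, hc, hcv⟩ := ih (fun v hv => hT v (mem_insert_of_mem hv))
      (Function.update c₀ w i) (by
        intro a b ha hb hab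
        by_cases haw : a = w
        · subst haw
          rw [Function.update_self, Function.update_of_ne hab.ne']
          exact (hi' b (hN b hab)).symm
        by_cases hbw : b = w
        · subst hbw
          rw [Function.update_self, Function.update_of_ne hab.ne]
          exact hi' a (hN a hab.symm)
        rw [Function.update_of_ne haw, Function.update_of_ne hbw]
        exact hc₀ a b (by simp [haw, ha]) (by simp [hbw, hb]) hab)
    refine ⟨c, hc, fun v hv => ?_⟩
    rw [mem_insert, not_or] at hv
    rw [hcv v hv.2, Function.update_of_ne hv.1]

theorem pow_mul_numColorings_completeOn (x : ℕ) (K : Finset V) :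
    (x : ℤ) ^ #K * (completeOn K).numColorings x
      = x ^ Fintype.card V * (descPochhammer ℤ #K).eval (x : ℤ) := by
  classical
  induction K using Finset.induction_on with
  | empty =>
    have : (completeOn (∅ : Finset V)).properColorings x = univ := by
      ext c; simp [mem_properColorings, completeOn_adj]
    simp [numColorings_eq_card, this]
  | insert w K hw ih =>
    have hiso : ∀ v, ¬ (completeOn K).Adj w v := fun v h => hw h.1
    have key := mul_card_filter_mem ((completeOn K).properColorings x) w
      (fun c hc i => update_mem_properColorings hiso hc i) (fun c => (K.image c)ᶜ) (by
        intro c i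
        congr 1
        refine image_congr fun v hv => ?_
        rw [Function.update_of_ne]
        rintro rfl
        exact hw hv)
    have h1 : ((completeOn K).properColorings x).filter (fun c => c w ∈ (K.image c)ᶜ)
        = (completeOn (insert w K)).properColorings x := by
      ext c
      simp only [mem_filter, mem_properColorings, completeOn_adj, mem_compl, mem_image,
        not_exists, not_and, mem_insert]
      constructor
      · rintro ⟨h, h'⟩ a b ⟨rfl | ha, rfl | hb, hab⟩
        · exact absurd rfl hab
        · exact fun he => h' b hb he.symm
        · exact h' a ha
        · exact h a b ⟨ha, hb, hab⟩
      · intro h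
        refine ⟨fun a b hab => h a b ⟨Or.inr hab.1, Or.inr hab.2.1, hab.2.2⟩, fun a ha => ?_⟩
        exact h a w ⟨Or.inr ha, Or.inl rfl, by rintro rfl; exact hw ha⟩
    have h2 : ∀ c ∈ (completeOn K).properColorings x,
        ((#(K.image c)ᶜ : ℕ) : ℤ) = (x : ℤ) - #K := by
      intro c hc
      have hinj : Set.InjOn c K := by
        intro a ha b hb hab
        by_contra hne
        exact mem_properColorings.1 hc a b ⟨ha, hb, hne⟩ hab
      rw [card_compl, Fintype.card_fin, card_image_of_injOn hinj, Nat.cast_sub]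
      rw [← card_image_of_injOn hinj]
      simpa using card_le_univ (K.image c)
    rw [h1, ← numColorings_eq_card] at key
    zify at key
    rw [sum_congr rfl h2, sum_const, ← numColorings_eq_card, nsmul_eq_mul] at key
    rw [card_insert_of_notMem hw, descPochhammer_succ_eval, ← mul_assoc, ← ih, pow_succ, mul_assoc,
      key]
    ring

end Counting

/-! ### The number of colorings of a path with distinct end colors -/

/-- The number of proper colorings, with `y + 1` colors, of the interior of a path with `a` edges
whose ends carry two given distinct colors; it equals `(y ^ a - (-1) ^ a) / (y + 1)`. -/
def pathColorings (y : ℤ) : ℕ → ℤ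
  | 0 => 0
  | a + 1 => y ^ a - pathColorings y a

theorem pathColorings_succ (y : ℤ) (a : ℕ) :
    pathColorings y (a + 1) = y ^ a - pathColorings y a := rfl

theorem add_one_mul_pathColorings (y : ℤ) (a : ℕ) :
    (y + 1) * pathColorings y a = y ^ a - (-1) ^ a := by
  induction a with
  | zero => simp [pathColorings]
  | succ a ih =>
    rw [pathColorings_succ, mul_sub, ih]
    ring

theorem pathColorings_add (y : ℤ) (a b : ℕ) :
    pathColorings y (a + b) = y ^ b * pathColorings y a + (-1) ^ a * pathColorings y b := by
  induction b with
  | zero => simp [pathColorings]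
  | succ b ih =>
    have h := add_one_mul_pathColorings y a
    rw [← add_assoc, pathColorings_succ, pathColorings_succ, ih]
    linear_combination -y ^ b * h

theorem pathColorings_bounds {y : ℤ} (hy : 1 ≤ y) (a : ℕ) :
    0 ≤ pathColorings y a ∧ pathColorings y a ≤ y ^ a := by
  induction a with
  | zero => simp [pathColorings]
  | succ a ih =>
    have h : y ^ a ≤ y ^ (a + 1) := pow_le_pow_right₀ hy (Nat.le_succ a)
    rw [pathColorings_succ]
    omega

theorem pathColorings_mono {y : ℤ} (hy : 2 ≤ y) : Monotone (pathColorings y) := by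
  refine monotone_nat_of_le_succ fun a => ?_
  rw [pathColorings_succ]
  cases a with
  | zero => simp [pathColorings]
  | succ a =>
    have h := (pathColorings_bounds (by omega : 1 ≤ y) a).1
    have h2 : 0 ≤ y ^ a := by positivity
    rw [pathColorings_succ, pow_succ]
    nlinarith

theorem pathColorings_one (y : ℤ) : pathColorings y 1 = 1 := by simp [pathColorings]

theorem pathColorings_two (y : ℤ) : pathColorings y 2 = y - 1 := by simp [pathColorings]

theorem pathColorings_three (y : ℤ) : pathColorings y 3 = y ^ 2 - y + 1 := by
  simp [pathColorings]; ring

theorem one_le_pathColorings {y : ℤ} (hy : 2 ≤ y) {a : ℕ} (ha : 1 ≤ a) :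
    1 ≤ pathColorings y a :=
  (pathColorings_one y).symm.le.trans (pathColorings_mono hy ha)

/-- Two consecutive ears, with `a` and `b + 1` edges, lose at least one coloring against a single
ear with `a + b` edges, once the first ear already misses one. -/
theorem pathColorings_succ_add_one_mul_sub_one_le {y : ℤ} (hy : 2 ≤ y) (a : ℕ) {b : ℕ}
    (hb : 1 ≤ b) :
    (pathColorings y (b + 1) + 1) * (pathColorings y a - 1) ≤ pathColorings y (a + b) - 1 := by
  have hpb := one_le_pathColorings hy hb
  have hpa := (pathColorings_bounds (by omega : 1 ≤ y) a).1
  have h2 : 2 * pathColorings y b ≤ y ^ b := by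
    obtain ⟨b, rfl⟩ := Nat.exists_eq_add_of_le' hb
    have h := (pathColorings_bounds (by omega : 1 ≤ y) b).1
    have h' : 0 ≤ y ^ b := by positivity
    rw [pathColorings_succ, pow_succ]
    nlinarith
  have h3 : 0 ≤ pathColorings y a * (pathColorings y b - 1) :=
    mul_nonneg hpa (by omega)
  rw [pathColorings_add y a b, pathColorings_succ y b]
  rcases neg_one_pow_eq_or ℤ a with h | h <;> rw [h] <;> nlinarith

/-- The same comparison when the first ear attains its maximum. It fails for `b = 1` and odd `a`,
where the left-hand side is `pathColorings y (a + 1) + 1`. -/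
theorem pathColorings_succ_add_one_mul_le {y : ℤ} (hy : 3 ≤ y) {a b : ℕ} (ha : 2 ≤ a) (hb : 1 ≤ b)
    (hab : Even a ∨ 2 ≤ b) :
    (pathColorings y (b + 1) + 1) * pathColorings y a ≤ pathColorings y (a + b) - 1 := by
  have hpb := one_le_pathColorings (by omega : 2 ≤ y) hb
  have hpa := (pathColorings_bounds (by omega : 1 ≤ y) a).1
  rw [pathColorings_add y a b, pathColorings_succ y b]
  rcases Nat.even_or_odd a with h | h
  · have h3 : 0 ≤ pathColorings y a * (pathColorings y b - 1) := mul_nonneg hpa (by omega)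
    rw [h.neg_one_pow]
    nlinarith
  · have hb2 : 2 ≤ b := hab.resolve_left (Nat.not_even_iff_odd.2 h)
    have ha3 : 3 ≤ a := by
      rcases h with ⟨r, rfl⟩
      omega
    have h4 := pathColorings_mono (by omega : 2 ≤ y) hb2
    have h5 := pathColorings_mono (by omega : 2 ≤ y) ha3
    rw [pathColorings_two] at h4
    rw [pathColorings_three] at h5
    have h6 : 7 ≤ pathColorings y a := by nlinarith
    have h7 : 7 * (pathColorings y b - 1) ≤ pathColorings y a * (pathColorings y b - 1) :=
      mul_le_mul_of_nonneg_right h6 (by omega)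
    rw [h.neg_one_pow]
    nlinarith

/-! ### Ears and their colorings -/

section Ears

variable {V : Type*}

/-- The graph whose edges join consecutive terms among `u 0, u 1, …, u l`. -/
def seqPath (u : ℕ → V) (l : ℕ) : SimpleGraph V where
  Adj a b := a ≠ b ∧ ∃ i < l, (a = u i ∧ b = u (i + 1)) ∨ (b = u i ∧ a = u (i + 1))
  symm := ⟨fun _ _ h => ⟨h.1.symm, h.2.imp fun _ h => ⟨h.1, h.2.symm⟩⟩⟩
  loopless := ⟨fun _ h => h.1 rfl⟩

theorem seqPath_adj {u : ℕ → V} {l : ℕ} {a b : V} : (seqPath u l).Adj a b ↔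
    a ≠ b ∧ ∃ i < l, (a = u i ∧ b = u (i + 1)) ∨ (b = u i ∧ a = u (i + 1)) := Iff.rfl

theorem seqPath_zero (u : ℕ → V) : seqPath u 0 = ⊥ := by
  ext a b
  simp [seqPath_adj]

theorem seqPath_succ (u : ℕ → V) (l : ℕ) :
    seqPath u (l + 1) = seqPath u l ⊔ edge (u l) (u (l + 1)) := by
  ext a b
  simp only [sup_adj, seqPath_adj, edge_adj]
  constructor
  · rintro ⟨hab, i, hi, h⟩
    rcases Nat.lt_succ_iff_lt_or_eq.1 hi with hi | rfl
    · exact Or.inl ⟨hab, i, hi, h⟩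
    · exact Or.inr ⟨by tauto, hab⟩
  · rintro (⟨hab, i, hi, h⟩ | ⟨h, hab⟩)
    · exact ⟨hab, i, by omega, h⟩
    · exact ⟨hab, l, by omega, by tauto⟩

/-- The sequence `u 0, u 1, …, u (m + 1)` of distinct vertices meets `S` exactly in its two ends;
that is, it is an open ear on `S` with `m` internal vertices. -/
structure IsEar (S : Finset V) (u : ℕ → V) (m : ℕ) : Prop where
  injOn : Set.InjOn u {i | i ≤ m + 1}
  first_mem : u 0 ∈ S
  last_mem : u (m + 1) ∈ S
  notMem : ∀ i, 1 ≤ i → i ≤ m → u i ∉ S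

theorem IsEar.ends_ne {S : Finset V} {u : ℕ → V} {m : ℕ} (h : IsEar S u m) :
    u 0 ≠ u (m + 1) := fun he => by
  have := h.injOn (show 0 ≤ m + 1 by omega) (show m + 1 ≤ m + 1 by omega) he
  omega

/-- In a `2`-connected graph every vertex set with at least two elements that is not everything
has an ear: leave `S` along an edge `sv`, and return to `S` along a path avoiding `s`. -/
theorem IsTwoConnected.exists_isEar [Fintype V] {G : SimpleGraph V} (hG : G.IsTwoConnected)
    {S : Finset V} (hS : 2 ≤ #S) (hS' : S ≠ univ) :
    ∃ u m, 1 ≤ m ∧ IsEar S u m ∧ seqPath u (m + 1) ≤ G := by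
  classical
  obtain ⟨s, hs, v, hv, hsv⟩ : ∃ s ∈ S, ∃ v ∉ S, G.Adj s v := by
    obtain ⟨s, hs⟩ := card_pos.1 (by omega : 0 < #S)
    obtain ⟨v, hv⟩ : ∃ v, v ∉ S := by
      by_contra! h
      exact hS' (eq_univ_of_forall h)
    obtain ⟨p⟩ := hG.connected.preconnected s v
    obtain ⟨d, -, hd, hd'⟩ := p.exists_boundary_dart (S : Set V) hs hv
    exact ⟨d.fst, hd, d.snd, hd', d.adj⟩
  obtain ⟨t, ht, hts⟩ := exists_mem_ne (by omega : 1 < #S) s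
  obtain ⟨q⟩ := (hG.connected_deleteVert s).preconnected ⟨v, by simpa using hsv.ne'⟩
    ⟨t, by simpa using hts⟩
  obtain ⟨p, hp⟩ := q.toPath
  have hex : ∃ j, (p.getVert j : V) ∈ S := ⟨p.length, by simpa using ht⟩
  set j := Nat.find hex with hj
  have hjS : (p.getVert j : V) ∈ S := Nat.find_spec hex
  have hjmin : ∀ i < j, (p.getVert i : V) ∉ S := fun i hi => Nat.find_min hex hi
  have hjlen : j ≤ p.length := Nat.find_min' hex (by simpa using ht)
  have hj1 : 1 ≤ j := by
    by_contra! h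
    have h0 : j = 0 := by omega
    rw [h0] at hjS
    exact hv (by simpa using hjS)
  refine ⟨fun i => if i = 0 then s else p.getVert (i - 1), j, hj1, ⟨?_, ?_, ?_, ?_⟩, ?_⟩
  · intro a ha b hb hab
    have hne : ∀ i, (p.getVert i : V) ≠ s := fun i => (p.getVert i).2
    simp only [Set.mem_ofPred_eq] at ha hb
    dsimp only at hab
    split_ifs at hab with h1 h2 h2
    · omega
    · exact absurd hab.symm (hne _)
    · exact absurd hab (hne _)
    · have := hp.getVert_injOn (show a - 1 ≤ p.length by omega) (show b - 1 ≤ p.length by omega)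
        (Subtype.ext hab)
      omega
  · simpa using hs
  · simpa using hjS
  · intro i hi him
    simpa [show i ≠ 0 by omega] using hjmin (i - 1) (by omega)
  · have hadj : ∀ i < j + 1, G.Adj (if i = 0 then s else p.getVert (i - 1))
        (if i + 1 = 0 then s else p.getVert (i + 1 - 1)) := by
      intro i hi
      rcases Nat.eq_zero_or_pos i with rfl | hi0
      · simpa using hsv
      · have := p.adj_getVert_succ (i := i - 1) (by omega)
        rw [show i - 1 + 1 = i by omega, comap_adj] at this
        simpa [show i ≠ 0 by omega] using this
    rintro a b ⟨-, i, hi, ⟨rfl, rfl⟩ | ⟨rfl, rfl⟩⟩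
    · exact hadj i hi
    · exact (hadj i hi).symm

variable [Fintype V]

/-- Attaching the ear one pendant edge at a time and closing it with a last edge. -/
theorem pow_mul_numColorings_sup_seqPath_sup_edge {H : SimpleGraph V} {u : ℕ → V} {m : ℕ}
    (hu : Set.InjOn u {i | i ≤ m + 1}) (hH : ∀ i, 1 ≤ i → i ≤ m → ∀ v, ¬ H.Adj (u i) v) (x : ℕ)
    {j : ℕ} (hj : j ≤ m) :
    (x : ℤ) ^ j * (H ⊔ seqPath u j).numColorings x = ((x : ℤ) - 1) ^ j * H.numColorings x ∧
    (x : ℤ) ^ j * (H ⊔ seqPath u j ⊔ edge (u j) (u (m + 1))).numColorings x =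
      pathColorings ((x : ℤ) - 1) (j + 1) * H.numColorings x
        - (-1) ^ j * H.numColoringsSame (u 0) (u (m + 1)) x := by
  have hne : ∀ {a b}, a ≤ m + 1 → b ≤ m + 1 → a ≠ b → u a ≠ u b :=
    fun ha hb hab h => hab (hu ha hb h)
  induction j with
  | zero =>
    have h := numColorings_sup_edge H (hne (a := 0) (b := m + 1) (by omega) (by omega) (by omega)) x
    zify at h
    simp only [seqPath_zero, sup_bot_eq, pathColorings]
    constructor
    · simp
    · linear_combination h
  | succ j ih =>
    obtain ⟨ih1, ih2⟩ := ih (by omega)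
    have hiso : ∀ v, ¬ (H ⊔ seqPath u j).Adj (u (j + 1)) v := by
      intro v
      rw [sup_adj, seqPath_adj, not_or]
      refine ⟨hH _ (by omega) hj v, ?_⟩
      rintro ⟨-, i, hi, ⟨h, -⟩ | ⟨-, h⟩⟩
      · exact hne (by omega) (by omega) (by omega) h
      · exact hne (by omega) (by omega) (by omega) h
    have e : H ⊔ seqPath u (j + 1) = H ⊔ seqPath u j ⊔ edge (u j) (u (j + 1)) := by
      rw [seqPath_succ, sup_assoc]
    have n1 : u j ≠ u (j + 1) := hne (by omega) (by omega) (by omega)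
    have n2 : u (m + 1) ≠ u (j + 1) := hne (by omega) (by omega) (by omega)
    have n3 : u j ≠ u (m + 1) := hne (by omega) (by omega) (by omega)
    have h1 := mul_numColorings_sup_edge_of_isolated hiso n1 x
    have h2 := mul_numColoringsSame_sup_edge_of_isolated hiso n1 n2 n3 x
    have h3 := numColorings_sup_edge (H ⊔ seqPath u (j + 1)) n2.symm x
    rw [← e] at h1 h2
    zify at h2 h3
    have h4 : (x : ℤ) ^ (j + 1) * (H ⊔ seqPath u (j + 1)).numColorings x
        = ((x : ℤ) - 1) ^ (j + 1) * H.numColorings x := by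
      linear_combination (x : ℤ) ^ j * h1 + ((x : ℤ) - 1) * ih1
    refine ⟨h4, ?_⟩
    rw [pathColorings_succ _ (j + 1)]
    linear_combination (x : ℤ) ^ (j + 1) * h3 - (x : ℤ) ^ j * h2 - ih2 + h4

theorem pow_mul_numColorings_sup_seqPath {H : SimpleGraph V} {S : Finset V} {u : ℕ → V} {m : ℕ}
    (hu : IsEar S u m) (hH : ∀ a b, H.Adj a b → a ∈ S) (x : ℕ) :
    (x : ℤ) ^ m * (H ⊔ seqPath u (m + 1)).numColorings x =
      pathColorings ((x : ℤ) - 1) (m + 1) * H.numColorings x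
        - (-1) ^ m * H.numColoringsSame (u 0) (u (m + 1)) x := by
  have h := (pow_mul_numColorings_sup_seqPath_sup_edge hu.injOn
    (fun i h1 h2 v hv => hu.notMem i h1 h2 (hH _ _ hv)) x le_rfl).2
  rwa [sup_assoc, ← seqPath_succ] at h

end Ears

/-! ### A clique with one ear -/

section CliqueEar

variable {V : Type*} {K : Finset V} {u : ℕ → V} {m : ℕ}

theorem IsEar.adj_internal (hu : IsEar K u m) {i : ℕ} (hi : 1 ≤ i) (him : i ≤ m) {v : V}
    (h : (completeOn K ⊔ seqPath u (m + 1)).Adj (u i) v) : v = u (i - 1) ∨ v = u (i + 1) := by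
  rcases h with h | ⟨-, l, hl, ⟨h1, h2⟩ | ⟨h1, h2⟩⟩
  · exact absurd h.1 (hu.notMem i hi him)
  · have := hu.injOn (show i ≤ m + 1 by omega) (show l ≤ m + 1 by omega) h1
    exact Or.inr (this ▸ h2)
  · have := hu.injOn (show i ≤ m + 1 by omega) (show l + 1 ≤ m + 1 by omega) h2
    left
    rw [h1, this, Nat.add_sub_cancel]

section DecidableEq

variable [DecidableEq V]

/-- The internal vertices `u 1, …, u m` of an ear. -/
def internals (u : ℕ → V) (m : ℕ) : Finset V := (Icc 1 m).image u

theorem mem_internals {v : V} : v ∈ internals u m ↔ ∃ i, (1 ≤ i ∧ i ≤ m) ∧ u i = v := by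
  simp [internals]

theorem IsEar.disjoint_internals (hu : IsEar K u m) : Disjoint K (internals u m) := by
  rw [disjoint_right]
  intro v hv
  obtain ⟨i, hi, rfl⟩ := mem_internals.1 hv
  exact hu.notMem i hi.1 hi.2

theorem IsEar.card_internals (hu : IsEar K u m) : #(internals u m) = m := by
  rw [internals, card_image_of_injOn, Nat.card_Icc, Nat.add_sub_cancel]
  intro a ha b hb hab
  simp only [coe_Icc, Set.mem_Icc] at ha hb
  exact hu.injOn (show a ≤ m + 1 by omega) (show b ≤ m + 1 by omega) hab

theorem IsEar.card_union_internals (hu : IsEar K u m) : #(K ∪ internals u m) = #K + m := by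
  rw [card_union_of_disjoint hu.disjoint_internals, hu.card_internals]

theorem IsEar.mem_of_seqPath_adj (hu : IsEar K u m) {a b : V}
    (h : (seqPath u (m + 1)).Adj a b) : a ∈ K ∪ internals u m := by
  have key : ∀ i ≤ m + 1, u i ∈ K ∪ internals u m := by
    intro i hi
    rw [mem_union]
    rcases Nat.eq_zero_or_pos i with rfl | hi0
    · exact Or.inl hu.first_mem
    rcases hi.eq_or_lt with rfl | hi'
    · exact Or.inl hu.last_mem
    · exact Or.inr (mem_internals.2 ⟨i, ⟨hi0, by omega⟩, rfl⟩)
  obtain ⟨-, i, hi, ⟨rfl, -⟩ | ⟨-, rfl⟩⟩ := h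
  · exact key _ (by omega)
  · exact key _ (by omega)

theorem IsEar.mem_of_sup_seqPath_adj {H : SimpleGraph V} {u : ℕ → V} {m : ℕ}
    (hu : IsEar K u m) (hH : ∀ a b, H.Adj a b → a ∈ K) (a b : V)
    (h : (H ⊔ seqPath u (m + 1)).Adj a b) : a ∈ K ∪ internals u m := by
  rcases h with h | h
  · exact mem_union_left _ (hH a b h)
  · exact hu.mem_of_seqPath_adj h

theorem adj_completeOn_of_notMem_internals (hm : 1 ≤ m) {a b : V}
    (ha : a ∉ internals u m) (hb : b ∉ internals u m)
    (h : (completeOn K ⊔ seqPath u (m + 1)).Adj a b) : (completeOn K).Adj a b := by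
  rcases h with h | ⟨-, i, hi, h⟩
  · exact h
  · exfalso
    have h1 : ∀ l, 1 ≤ l → l ≤ m → u l ∈ internals u m := fun l h1 h2 =>
      mem_internals.2 ⟨l, ⟨h1, h2⟩, rfl⟩
    rcases Nat.eq_zero_or_pos i with rfl | hi0
    · rcases h with ⟨-, rfl⟩ | ⟨-, rfl⟩
      · exact hb (h1 1 le_rfl hm)
      · exact ha (h1 1 le_rfl hm)
    · rcases h with ⟨rfl, -⟩ | ⟨rfl, -⟩
      · exact ha (h1 i hi0 (by omega))
      · exact hb (h1 i hi0 (by omega))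

theorem IsEar.exists_neighbors (hu : IsEar K u m) {w : V} (hw : w ∈ internals u m) :
    ∃ N : Finset V, #N ≤ 2 ∧
      ∀ v, (completeOn K ⊔ seqPath u (m + 1)).Adj w v → v ∈ N := by
  obtain ⟨i, hi, rfl⟩ := mem_internals.1 hw
  refine ⟨{u (i - 1), u (i + 1)}, card_le_two, fun v hv => ?_⟩
  simpa using hu.adj_internal hi.1 hi.2 hv

end DecidableEq

variable [Fintype V]

theorem IsEar.pow_mul_numColorings_completeOn_sup (hu : IsEar K u m) (x : ℕ) :
    (x : ℤ) ^ m * (completeOn K ⊔ seqPath u (m + 1)).numColorings x =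
      pathColorings ((x : ℤ) - 1) (m + 1) * (completeOn K).numColorings x := by
  rw [pow_mul_numColorings_sup_seqPath hu (fun a b (h : (completeOn K).Adj a b) => h.1) x,
    numColoringsSame_of_adj (completeOn_adj.2 ⟨hu.first_mem, hu.last_mem, hu.ends_ne⟩)]
  simp

theorem IsEar.two_mul_le_of_mem_internals [DecidableEq V] (hu : IsEar K u m) (hm : 2 ≤ m) {x : ℕ}
    (hx : 4 ≤ x) {s t : V} (hs : s ∈ internals u m) :
    2 * (completeOn K).numColorings x ≤
      x ^ m * (completeOn K ⊔ seqPath u (m + 1) ⊔ edge s t).numColorings x := by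
  set H := completeOn K ⊔ seqPath u (m + 1) with hH
  obtain ⟨N, hN2, hN⟩ := hu.exists_neighbors hs
  have h1 := numColorings_avoid_singleton_le (H := H ⊔ edge s t) (w := s) (N := insert t N) (by
    intro v hv
    rcases hv with hv | hv
    · exact mem_insert_of_mem (hN v hv)
    · rw [edge_adj] at hv
      rcases hv with ⟨⟨-, rfl⟩ | ⟨rfl, rfl⟩, h⟩
      · exact mem_insert_self _ _
      · exact absurd rfl h) x
  set H' := (H ⊔ edge s t).avoid {s} with hH'
  have hadj : ∀ a b, H'.Adj a b → H.Adj a b ∧ a ≠ s ∧ b ≠ s := by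
    rintro a b ⟨h | h, ha, hb⟩
    · exact ⟨h, by simpa using ha, by simpa using hb⟩
    · rw [edge_adj] at h
      rcases h with ⟨⟨rfl, -⟩ | ⟨-, rfl⟩, -⟩
      · simp at ha
      · simp at hb
  have h2 := numColorings_avoid_le (H := H') (d := 2) x ((internals u m).erase s) (by
    intro w hw
    obtain ⟨N, hN, hN'⟩ := hu.exists_neighbors (mem_of_mem_erase hw)
    exact ⟨N, hN, fun v hv => hN' v (hadj _ _ hv).1⟩)
  have h3 : H'.avoid ((internals u m).erase s) ≤ completeOn K := by
    rintro a b ⟨h, ha, hb⟩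
    obtain ⟨h, has, hbs⟩ := hadj a b h
    exact adj_completeOn_of_notMem_internals (by omega) (fun h => ha (mem_erase.2 ⟨has, h⟩))
      (fun h => hb (mem_erase.2 ⟨hbs, h⟩)) h
  rw [card_erase_of_mem hs, hu.card_internals] at h2
  have h4 := numColorings_anti h3 x
  have h5 : 1 ≤ x - #(insert t N) := by
    have := card_insert_le t N
    omega
  have h6 : 2 ≤ (x - 2) ^ (m - 1) :=
    calc 2 ≤ x - 2 := by omega
      _ ≤ (x - 2) ^ (m - 1) := Nat.le_self_pow (by omega) _
  calc 2 * (completeOn K).numColorings x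
      ≤ (x - 2) ^ (m - 1) * (H'.avoid ((internals u m).erase s)).numColorings x := by gcongr
    _ ≤ x ^ (m - 1) * H'.numColorings x := h2
    _ ≤ x ^ (m - 1) * ((x - #(insert t N)) * H'.numColorings x) :=
        Nat.mul_le_mul_left _ (Nat.le_mul_of_pos_left _ h5)
    _ ≤ x ^ (m - 1) * (x * (H ⊔ edge s t).numColorings x) := by gcongr
    _ = x ^ m * (H ⊔ edge s t).numColorings x := by
        rw [← mul_assoc, ← pow_succ, Nat.sub_add_cancel (by omega)]

/-- If the ear has at least two internal vertices, then any two vertices of the clique with its ear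
receive distinct colors in at least twice as many colorings as the clique has: if one of them is
internal, color it last, all other internal vertices having at least two choices each. -/
theorem IsEar.two_mul_le_numColorings_sup_edge [DecidableEq V] (hu : IsEar K u m) (hm : 2 ≤ m)
    {x : ℕ} (hx : 4 ≤ x) {s t : V} (hs : s ∈ K ∪ internals u m) (ht : t ∈ K ∪ internals u m)
    (hst : s ≠ t) :
    2 * (completeOn K).numColorings x ≤
      x ^ m * (completeOn K ⊔ seqPath u (m + 1) ⊔ edge s t).numColorings x := by
  rw [mem_union] at hs ht
  rcases hs with hs | hs
  · rcases ht with ht | ht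
    · have h : completeOn K ⊔ seqPath u (m + 1) ⊔ edge s t ≤
          completeOn K ⊔ seqPath u (m + 1) := by
        rw [sup_le_iff]
        refine ⟨le_rfl, fun a b hab => Or.inl ?_⟩
        rw [edge_adj] at hab
        rcases hab with ⟨⟨rfl, rfl⟩ | ⟨rfl, rfl⟩, hab⟩
        · exact ⟨hs, ht, hab⟩
        · exact ⟨ht, hs, hab⟩
      have h1 := numColorings_anti h x
      have h2 := hu.pow_mul_numColorings_completeOn_sup x
      have h3 : 2 ≤ pathColorings ((x : ℤ) - 1) (m + 1) := by
        have := pathColorings_mono (y := (x : ℤ) - 1) (by omega) (show 2 ≤ m + 1 by omega)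
        rw [pathColorings_two] at this
        omega
      refine le_trans ?_ (Nat.mul_le_mul_left _ h1)
      zify
      rw [h2]
      gcongr
    · rw [edge_comm]
      exact hu.two_mul_le_of_mem_internals hm hx ht
  · exact hu.two_mul_le_of_mem_internals hm hx hs

/-- Two vertices not joined in the clique with its ear can be given the same color: color the
clique and these two first, the remaining internal vertices have only two neighbors. -/
theorem IsEar.exists_mem_properColorings_eq [DecidableEq V] (hu : IsEar K u m)
    {x : ℕ} (hx : 3 ≤ x) (hKx : #K ≤ x) {s t : V} (hs : s ∈ K ∪ internals u m)
    (ht : t ∈ K ∪ internals u m) (hst : s ≠ t)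
    (hadj : ¬ (completeOn K ⊔ seqPath u (m + 1)).Adj s t) :
    ∃ c ∈ (completeOn K ⊔ seqPath u (m + 1)).properColorings x, c s = c t := by
  wlog hti : t ∈ internals u m generalizing s t
  · have htK : t ∈ K := (mem_union.1 ht).resolve_right hti
    have hsi : s ∈ internals u m := (mem_union.1 hs).resolve_left fun hsK =>
      hadj (Or.inl ⟨hsK, htK, hst⟩)
    obtain ⟨c, hc, h⟩ := this ht hs hst.symm (fun h => hadj h.symm) hsi
    exact ⟨c, hc, h.symm⟩
  obtain ⟨f, hf⟩ : ∃ f : V → Fin x, Set.InjOn f K := by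
    obtain ⟨e⟩ : Nonempty (K ↪ Fin x) :=
      Function.Embedding.nonempty_of_card_le (by simpa using hKx)
    refine ⟨fun v => if h : v ∈ K then e ⟨v, h⟩ else ⟨0, by omega⟩, fun a ha b hb hab => ?_⟩
    have ha' : a ∈ K := ha
    have hb' : b ∈ K := hb
    simpa [ha', hb'] using hab
  have hnot : ∀ {v}, v ∈ internals u m → v ∉ K := fun h => disjoint_right.1 hu.disjoint_internals h
  -- A color for `s` and `t` that none of their neighbors in the clique has.
  obtain ⟨i, hi, hsi⟩ : ∃ i, (∀ v ∈ K, v ≠ s →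
      ((completeOn K ⊔ seqPath u (m + 1)).Adj s v ∨ (completeOn K ⊔ seqPath u (m + 1)).Adj t v) →
      f v ≠ i) ∧ (s ∈ K → f s = i) := by
    by_cases hsK : s ∈ K
    · exact ⟨f s, fun v hv hvs _ h => hvs (hf hv hsK h), fun _ => rfl⟩
    · obtain ⟨i, hi⟩ : ∃ i, i ∉ ({f (u 0), f (u (m + 1))} : Finset (Fin x)) := by
        by_contra! h
        have h1 : #(univ : Finset (Fin x)) ≤ 2 := (card_le_card fun i _ => h i).trans card_le_two
        rw [card_univ, Fintype.card_fin] at h1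
        omega
      simp only [mem_insert, mem_singleton, not_or] at hi
      refine ⟨i, fun v hv _ h => ?_, fun h => absurd h hsK⟩
      have hend : ∀ w ∈ internals u m, (completeOn K ⊔ seqPath u (m + 1)).Adj w v →
          v = u 0 ∨ v = u (m + 1) := by
        intro w hw hwv
        obtain ⟨l, hl, rfl⟩ := mem_internals.1 hw
        have hends : ∀ j ≤ m + 1, u j ∈ K → j = 0 ∨ j = m + 1 := by
          intro j hj hjK
          by_contra! h
          exact hu.notMem j (by omega) (by omega) hjK
        rcases hu.adj_internal hl.1 hl.2 hwv with rfl | rfl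
        · rcases hends _ (by omega) hv with h | h <;> rw [h] <;> simp
        · rcases hends _ (by omega) hv with h | h <;> rw [h] <;> simp
      have hsint : s ∈ internals u m := (mem_union.1 hs).resolve_left hsK
      have hv' : v = u 0 ∨ v = u (m + 1) := h.elim (hend s hsint) (hend t hti)
      rcases hv' with rfl | rfl
      · exact fun h => hi.1 h.symm
      · exact fun h => hi.2 h.symm
  obtain ⟨c, hc, hcv⟩ := exists_properColoring_extending
    (H := completeOn K ⊔ seqPath u (m + 1)) (x := x) (((internals u m).erase s).erase t) (by
      intro w hw
      obtain ⟨N, hN, hN'⟩ := hu.exists_neighbors (mem_of_mem_erase (mem_of_mem_erase hw))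
      exact ⟨N, by omega, hN'⟩) (fun v => if v = s ∨ v = t then i else f v) (by
      intro a b ha hb hab
      have hcase : ∀ {v}, v ∉ ((internals u m).erase s).erase t → v ≠ s → v ≠ t →
          v ∉ internals u m := fun h h1 h2 h3 =>
        h (mem_erase.2 ⟨h2, mem_erase.2 ⟨h1, h3⟩⟩)
      have hKmem : ∀ {v w}, v ∉ internals u m →
          (completeOn K ⊔ seqPath u (m + 1)).Adj v w → v ∈ K := by
        rintro v w hv (h | h)
        · exact h.1
        · exact (mem_union.1 (hu.mem_of_seqPath_adj h)).resolve_right hv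
      split_ifs with h1 h2 h2
      · exfalso
        rcases h1 with rfl | rfl <;> rcases h2 with rfl | rfl
        · exact hab.ne rfl
        · exact hadj hab
        · exact hadj hab.symm
        · exact hab.ne rfl
      · rw [not_or] at h2
        have hbK := hKmem (hcase hb h2.1 h2.2) hab.symm
        refine (hi b hbK h2.1 ?_).symm
        rcases h1 with rfl | rfl
        · exact Or.inl hab
        · exact Or.inr hab
      · rw [not_or] at h1
        have haK := hKmem (hcase ha h1.1 h1.2) hab
        refine hi a haK h1.1 ?_
        rcases h2 with rfl | rfl
        · exact Or.inl hab.symm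
        · exact Or.inr hab.symm
      · rw [not_or] at h1 h2
        have haK := hKmem (hcase ha h1.1 h1.2) hab
        have hbK := hKmem (hcase hb h2.1 h2.2) hab.symm
        exact fun h => hab.ne (hf haK hbK h))
  refine ⟨c, hc, ?_⟩
  rw [hcv s (by simp), hcv t (by simp)]
  simp

end CliqueEar

/-! ### Several ears -/

section SeveralEars

variable {V : Type*} [Fintype V] {G : SimpleGraph V} {K S : Finset V} {x : ℕ}

/-- Some subgraph of `G` on the vertex set `S ⊇ K` has fewer colorings than the complete graph
on `K` with a single ear covering `S`, with a deficit of at least one coloring for each coloring of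
the complete graph. The vertices outside `S` are isolated in all graphs compared, and the powers
of `x` account for them. -/
def IsDeficient (G : SimpleGraph V) (K : Finset V) (x : ℕ) (S : Finset V) : Prop :=
  ∃ H ≤ G, (∀ a b, H.Adj a b → a ∈ S) ∧ ∃ M, 1 ≤ M ∧ #S = #K + M ∧
    (x : ℤ) ^ M * H.numColorings x ≤
      (pathColorings ((x : ℤ) - 1) (M + 1) - 1) * (completeOn K).numColorings x

theorem IsEar.pow_mul_numColorings_sup_seqPath_le {H : SimpleGraph V} {u : ℕ → V} {m : ℕ}
    (hu : IsEar S u m) (hH : ∀ a b, H.Adj a b → a ∈ S) (x : ℕ) :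
    (x : ℤ) ^ m * (H ⊔ seqPath u (m + 1)).numColorings x ≤
      (pathColorings ((x : ℤ) - 1) (m + 1) + 1) * H.numColorings x := by
  rw [pow_mul_numColorings_sup_seqPath hu hH x, add_mul, one_mul]
  have h1 : (H.numColoringsSame (u 0) (u (m + 1)) x : ℤ) ≤ H.numColorings x := by
    exact_mod_cast numColoringsSame_le H _ _ x
  rcases neg_one_pow_eq_or ℤ m with h | h <;> rw [h] <;> omega

theorem IsDeficient.union_internals [DecidableEq V] (hS : IsDeficient G K x S) (hx : 4 ≤ x)
    {u : ℕ → V} {m : ℕ} (hm : 1 ≤ m) (hu : IsEar S u m) (huG : seqPath u (m + 1) ≤ G) :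
    IsDeficient G K x (S ∪ internals u m) := by
  obtain ⟨H, hHG, hHS, M, hM, hcard, hle⟩ := hS
  refine ⟨H ⊔ seqPath u (m + 1), sup_le hHG huG, hu.mem_of_sup_seqPath_adj hHS, M + m,
    by omega, ?_, ?_⟩
  · rw [hu.card_union_internals, hcard, add_assoc]
  · have h1 := hu.pow_mul_numColorings_sup_seqPath_le hHS x
    have h2 := pathColorings_succ_add_one_mul_sub_one_le (y := (x : ℤ) - 1) (by omega) (M + 1) hm
    have h3 := (pathColorings_bounds (y := (x : ℤ) - 1) (by omega) (m + 1)).1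
    rw [show M + 1 + m = M + m + 1 by omega] at h2
    calc (x : ℤ) ^ (M + m) * (H ⊔ seqPath u (m + 1)).numColorings x
        = x ^ M * (x ^ m * (H ⊔ seqPath u (m + 1)).numColorings x) := by rw [pow_add, mul_assoc]
      _ ≤ x ^ M * ((pathColorings ((x : ℤ) - 1) (m + 1) + 1) * H.numColorings x) := by gcongr
      _ = (pathColorings ((x : ℤ) - 1) (m + 1) + 1) * (x ^ M * H.numColorings x) := by ring
      _ ≤ (pathColorings ((x : ℤ) - 1) (m + 1) + 1) *
          ((pathColorings ((x : ℤ) - 1) (M + 1) - 1) * (completeOn K).numColorings x) := by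
        gcongr
      _ ≤ _ := by
        rw [← mul_assoc]
        gcongr

/-- A second ear makes the graph deficient. The only case not settled by the crude estimate for
an ear is a second ear with a single internal vertex, after a first ear of odd length. -/
theorem isDeficient_of_two_ears [DecidableEq V] (hx : 4 ≤ x) (hKG : completeOn K ≤ G)
    {u : ℕ → V} {M : ℕ} (hM : 1 ≤ M) (hu : IsEar K u M) (huG : seqPath u (M + 1) ≤ G)
    {w : ℕ → V} {m : ℕ} (hm : 1 ≤ m) (hw : IsEar (K ∪ internals u M) w m)
    (hwG : seqPath w (m + 1) ≤ G) :
    IsDeficient G K x (K ∪ internals u M ∪ internals w m) := by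
  set H := completeOn K ⊔ seqPath u (M + 1) with hH
  have hHS : ∀ a b, H.Adj a b → a ∈ K ∪ internals u M :=
    hu.mem_of_sup_seqPath_adj fun a b h => h.1
  refine ⟨H ⊔ seqPath w (m + 1), sup_le (sup_le hKG huG) hwG, hw.mem_of_sup_seqPath_adj hHS, M + m,
    by omega, ?_, ?_⟩
  · rw [hw.card_union_internals, hu.card_union_internals, add_assoc]
  have hF := hu.pow_mul_numColorings_completeOn_sup x
  rw [← hH] at hF
  by_cases hcase : Even (M + 1) ∨ 2 ≤ m
  · have h1 := hw.pow_mul_numColorings_sup_seqPath_le hHS x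
    have h2 := pathColorings_succ_add_one_mul_le (y := (x : ℤ) - 1) (by omega)
      (by omega : 2 ≤ M + 1) hm hcase
    rw [show M + 1 + m = M + m + 1 by omega] at h2
    calc (x : ℤ) ^ (M + m) * (H ⊔ seqPath w (m + 1)).numColorings x
        = x ^ M * (x ^ m * (H ⊔ seqPath w (m + 1)).numColorings x) := by rw [pow_add, mul_assoc]
      _ ≤ x ^ M * ((pathColorings ((x : ℤ) - 1) (m + 1) + 1) * H.numColorings x) := by gcongr
      _ = (pathColorings ((x : ℤ) - 1) (m + 1) + 1) * pathColorings ((x : ℤ) - 1) (M + 1) *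
          (completeOn K).numColorings x := by
        linear_combination (pathColorings ((x : ℤ) - 1) (m + 1) + 1) * hF
      _ ≤ _ := by gcongr
  · rw [not_or, Nat.not_even_iff_odd] at hcase
    obtain ⟨hodd, hm2⟩ := hcase
    obtain rfl : m = 1 := by omega
    have hM2 : 2 ≤ M := by
      rcases hodd with ⟨r, hr⟩
      omega
    have h1 := pow_mul_numColorings_sup_seqPath hw hHS x
    have h2 := numColorings_sup_edge H hw.ends_ne x
    have h3 := hu.two_mul_le_numColorings_sup_edge hM2 hx hw.first_mem hw.last_mem hw.ends_ne
    have h4 := add_one_mul_pathColorings ((x : ℤ) - 1) (M + 1)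
    rw [← hH] at h3
    zify at h2 h3
    rw [pathColorings_two, pow_one, pow_one] at h1
    rw [hodd.neg_one_pow] at h4
    rw [pathColorings_succ _ (M + 1), pow_succ, mul_assoc, h1]
    linear_combination h3 + (x : ℤ) ^ M * h2 + ((x : ℤ) - 1) * hF
      + ((completeOn K).numColorings x : ℤ) * h4

theorem IsTwoConnected.isDeficient_univ (hG : G.IsTwoConnected) (hK : 2 ≤ #K) (hx : 4 ≤ x)
    (hS : IsDeficient G K x S) : IsDeficient G K x univ := by
  classical
  induction h : Fintype.card V - #S using Nat.strong_induction_on generalizing S with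
  | _ d ih =>
    by_cases hSu : S = univ
    · exact hSu ▸ hS
    have hS2 : 2 ≤ #S := by
      obtain ⟨H, -, -, M, -, hcard, -⟩ := hS
      omega
    obtain ⟨u, m, hm, hu, huG⟩ := hG.exists_isEar hS2 hSu
    refine ih _ ?_ (hS.union_internals hx hm hu huG) rfl
    have h1 := hu.card_union_internals
    have h2 := card_le_univ (S ∪ internals u m)
    omega

end SeveralEars

/-! ### Recognizing the extremal graph -/

section Extremal

variable {V : Type*}

theorem cliqueWithEar_adj_iff {n k : ℕ} (hk : 2 ≤ k) (hkn : k < n) {K : Finset V} {u : ℕ → V}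
    {e : Fin n → V} (he : Function.Injective e) (hK : ∀ i, e i ∈ K ↔ i.val < k)
    (hu : ∀ j (h : k - 1 + j < n), u j = e ⟨k - 1 + j, h⟩)
    (hlast : u (n - k + 1) = e ⟨0, by omega⟩) (i j : Fin n) :
    (completeOn K ⊔ seqPath u (n - k + 1)).Adj (e i) (e j) ↔ (cliqueWithEar n k).Adj i j := by
  have key : ∀ i j : Fin n, (∃ l < n - k + 1, e i = u l ∧ e j = u (l + 1)) ↔
      (k - 1 ≤ i.val ∧ i.val + 1 = j.val) ∨ (i.val + 1 = n ∧ j.val = 0) := by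
    intro i j
    constructor
    · rintro ⟨l, hl, h1, h2⟩
      rw [hu l (by omega)] at h1
      have h1 := congrArg Fin.val (he h1)
      by_cases hl' : l + 1 = n - k + 1
      · rw [hl', hlast] at h2
        have h2 := congrArg Fin.val (he h2)
        simp only at h1 h2
        omega
      · rw [hu (l + 1) (by omega)] at h2
        have h2 := congrArg Fin.val (he h2)
        simp only at h1 h2
        omega
    · rintro (⟨h1, h2⟩ | ⟨h1, h2⟩)
      · refine ⟨i.val - (k - 1), by omega, ?_, ?_⟩
        · rw [hu _ (by omega)]
          congr 1
          ext
          simp only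
          omega
        · rw [hu _ (by omega)]
          congr 1
          ext
          simp only
          omega
      · refine ⟨n - k, by omega, ?_, ?_⟩
        · rw [hu _ (by omega)]
          congr 1
          ext
          simp only
          omega
        · rw [hlast]
          congr 1
          ext
          exact h2
  have key' : (∃ l < n - k + 1, (e i = u l ∧ e j = u (l + 1)) ∨ (e j = u l ∧ e i = u (l + 1))) ↔
      (∃ l < n - k + 1, e i = u l ∧ e j = u (l + 1)) ∨
      (∃ l < n - k + 1, e j = u l ∧ e i = u (l + 1)) := by
    constructor
    · rintro ⟨l, hl, h | h⟩
      · exact Or.inl ⟨l, hl, h⟩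
      · exact Or.inr ⟨l, hl, h⟩
    · rintro (⟨l, hl, h⟩ | ⟨l, hl, h⟩)
      · exact ⟨l, hl, Or.inl h⟩
      · exact ⟨l, hl, Or.inr h⟩
  rw [sup_adj, completeOn_adj, seqPath_adj, key', key i j, key j i, hK, hK, he.ne_iff,
    cliqueWithEar, fromRel_adj]
  generalize (k - 1 ≤ i.val ∧ i.val + 1 = j.val) = A
  generalize (k - 1 ≤ j.val ∧ j.val + 1 = i.val) = B
  generalize (i.val + 1 = n ∧ j.val = 0) = C
  generalize (j.val + 1 = n ∧ i.val = 0) = D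
  generalize (i.val < k) = P
  generalize (j.val < k) = Q
  clear * -
  by_cases h : i = j
  · simp [h]
  · simp only [h, ne_eq, not_false_eq_true, and_true, true_and]
    tauto

theorem IsEar.nonempty_iso_cliqueWithEar [Fintype V] [DecidableEq V] {K : Finset V} {u : ℕ → V}
    {m : ℕ} (hm : 1 ≤ m) (hK : 2 ≤ #K) (hu : IsEar K u m) (huniv : K ∪ internals u m = univ) :
    Nonempty (completeOn K ⊔ seqPath u (m + 1) ≃g cliqueWithEar (#K + m) #K) := by
  set k := #K with hk
  obtain ⟨g, hg0, hg1⟩ : ∃ g : Fin k ≃ K, (g ⟨0, by omega⟩ : V) = u (m + 1) ∧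
      (g ⟨k - 1, by omega⟩ : V) = u 0 := by
    let e : Fin k ≃ K := K.equivFin.symm
    let e₁ := (Equiv.swap ⟨0, by omega⟩ (e.symm ⟨u (m + 1), hu.last_mem⟩)).trans e
    have h1 : e₁ ⟨0, by omega⟩ = ⟨u (m + 1), hu.last_mem⟩ := by simp [e₁]
    let e₂ := (Equiv.swap ⟨k - 1, by omega⟩ (e₁.symm ⟨u 0, hu.first_mem⟩)).trans e₁
    have h2 : e₂ ⟨k - 1, by omega⟩ = ⟨u 0, hu.first_mem⟩ := by simp [e₂]
    refine ⟨e₂, ?_, by rw [h2]⟩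
    have h3 : e₂ ⟨0, by omega⟩ = e₁ ⟨0, by omega⟩ := by
      simp only [e₂, Equiv.trans_apply]
      rw [Equiv.swap_apply_of_ne_of_ne]
      · intro h
        have := congrArg Fin.val h
        simp only at this
        omega
      · intro h
        rw [Equiv.eq_symm_apply, h1] at h
        exact hu.ends_ne (congrArg Subtype.val h).symm
    rw [h3, h1]
  let f : Fin (k + m) → V := fun i => if h : i.val < k then g ⟨i, h⟩ else u (i.val - k + 1)
  have hfK : ∀ i, f i ∈ K ↔ i.val < k := by
    intro i
    by_cases h : i.val < k
    · simp [f, h]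
    · simpa [f, h] using hu.notMem (i.val - k + 1) (by omega) (by omega)
  have hf : Function.Injective f := by
    intro i j hij
    by_cases hi : i.val < k
    · have hj : j.val < k := by rwa [← hfK, ← hij, hfK]
      simp only [f, hi, hj, dif_pos] at hij
      have := g.injective (Subtype.ext hij)
      ext
      simpa using this
    · have hj : ¬ j.val < k := by rwa [← hfK, ← hij, hfK]
      simp only [f, hi, hj, dif_neg, not_false_eq_true] at hij
      have := hu.injOn (show i.val - k + 1 ≤ m + 1 by omega) (show j.val - k + 1 ≤ m + 1 by omega)
        hij
      ext
      omega
  have hcard : Fintype.card (Fin (k + m)) = Fintype.card V := by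
    rw [Fintype.card_fin, ← card_univ, ← huniv, hu.card_union_internals]
  have hfb : Function.Bijective f := (Fintype.bijective_iff_injective_and_card f).2 ⟨hf, hcard⟩
  have hadj := cliqueWithEar_adj_iff (n := k + m) (k := k) hK (by omega) hf hfK (u := u) (by
    intro j hj
    rcases Nat.eq_zero_or_pos j with rfl | hj0
    · simp only [f, add_zero, show k - 1 < k by omega, dif_pos, hg1]
    · simp only [f, show ¬ (k - 1 + j < k) by omega, dif_neg, not_false_eq_true]
      congr 1
      omega) (by
    simp only [f, show 0 < k by omega, dif_pos, hg0]
    congr 1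
    omega)
  rw [show k + m - k + 1 = m + 1 by omega] at hadj
  exact ⟨(RelIso.mk (Equiv.ofBijective f hfb) (fun {a b} => hadj a b)).symm⟩

theorem exists_isEar_of_iso_cliqueWithEar [Fintype V] {G : SimpleGraph V} {n k : ℕ} (hk : 2 ≤ k)
    (hkn : k < n) (φ : G ≃g cliqueWithEar n k) :
    ∃ (K : Finset V) (u : ℕ → V), #K = k ∧ IsEar K u (n - k) ∧
      G = completeOn K ⊔ seqPath u (n - k + 1) := by
  classical
  let e : Fin n → V := φ.symm
  have he : Function.Injective e := φ.symm.injective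
  let K : Finset V := (univ.filter fun i : Fin n => i.val < k).image e
  have hK : ∀ i, e i ∈ K ↔ i.val < k := by
    intro i
    simp only [K, he.mem_finset_image, mem_filter, mem_univ, true_and]
  let u : ℕ → V := fun j => if h : k - 1 + j < n then e ⟨k - 1 + j, h⟩ else e ⟨0, by omega⟩
  have hu : ∀ j (h : k - 1 + j < n), u j = e ⟨k - 1 + j, h⟩ := fun j h => dif_pos h
  have hlast : u (n - k + 1) = e ⟨0, by omega⟩ := dif_neg (by omega)
  refine ⟨K, u, ?_, ⟨?_, ?_, ?_, ?_⟩, ?_⟩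
  · rw [card_image_of_injective _ he]
    have : (univ.filter fun i : Fin n => i.val < k) = Iio (⟨k, hkn⟩ : Fin n) := by
      ext i
      simp [Fin.lt_def]
    rw [this, Fin.card_Iio]
  · intro a ha b hb hab
    simp only [Set.mem_ofPred_eq] at ha hb
    simp only [u] at hab
    split_ifs at hab with h1 h2 h2 <;> have h3 := congrArg Fin.val (he hab) <;>
      simp only at h3 <;> omega
  · rw [hu 0 (by omega), hK]
    simp only
    omega
  · rw [hlast, hK]
    simp only
    omega
  · intro i hi him
    rw [hu i (by omega), hK]
    simp only
    omega
  · ext a b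
    have h := cliqueWithEar_adj_iff hk hkn he hK hu hlast (φ a) (φ b)
    simp only [e, RelIso.symm_apply_apply] at h
    rw [h]
    exact φ.map_adj_iff.symm

end Extremal

/-! ### The bound and its equality case -/

/-- The extremal value, in terms of the colorings of the clique. -/
theorem pow_mul_bound_eq {V : Type*} [Fintype V] {K : Finset V} {n k : ℕ}
    (hn : Fintype.card V = n) (hK : #K = k) (hk : 1 ≤ k) (hkn : k < n) {x : ℕ} (hx : k ≤ x) :
    (x : ℤ) ^ (n - k) * ((descPochhammer ℤ (k - 1)).eval ((x : ℤ) - 1) *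
      (((x : ℤ) - 1) ^ (n - k + 1) + (-1) ^ (n - k))) =
      pathColorings ((x : ℤ) - 1) (n - k + 1) * (completeOn K).numColorings x := by
  have h1 := pow_mul_numColorings_completeOn x K
  have h2 := add_one_mul_pathColorings ((x : ℤ) - 1) (n - k + 1)
  have h3 : (descPochhammer ℤ k).eval (x : ℤ)
      = x * (descPochhammer ℤ (k - 1)).eval ((x : ℤ) - 1) := by
    obtain ⟨r, rfl⟩ := Nat.exists_eq_add_of_le' hk
    rw [descPochhammer_succ_left]
    simp
  have hx0 : (x : ℤ) ^ k ≠ 0 := pow_ne_zero _ (by omega)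
  rw [hK, hn, ← Nat.sub_add_cancel hkn.le, pow_add, h3] at h1
  refine mul_left_cancel₀ hx0 ?_
  rw [pow_succ (-1 : ℤ)] at h2
  linear_combination (-1) * pathColorings ((x : ℤ) - 1) (n - k + 1) * h1
    - (x : ℤ) ^ (n - k) * (x : ℤ) ^ k * (descPochhammer ℤ (k - 1)).eval ((x : ℤ) - 1) * h2

theorem numColorings_completeOn_pos {V : Type*} [Fintype V] {K : Finset V} {x : ℕ}
    (hx : 1 ≤ x) (hKx : #K ≤ x) : 0 < (completeOn K).numColorings x := by
  have h := numColorings_avoid_le (H := completeOn K) (d := x - 1) x K (by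
    classical
    intro w hw
    refine ⟨K.erase w, ?_, fun v hv => mem_erase.2 ⟨hv.2.2.symm, hv.2.1⟩⟩
    rw [card_erase_of_mem hw]
    omega)
  have h' : ((completeOn K).avoid K) = ⊥ := by
    ext a b
    simp only [avoid_adj, completeOn_adj, bot_adj]
    tauto
  rw [h', numColorings_eq_card] at h
  have h2 : 0 < #((⊥ : SimpleGraph V).properColorings x) :=
    card_pos.2 ⟨fun _ => ⟨0, hx⟩, mem_properColorings.2 fun _ _ h => absurd h (by simp)⟩
  have h3 : 0 < (x - (x - 1)) ^ #K := pow_pos (by omega) _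
  exact Nat.pos_of_mul_pos_left ((Nat.mul_pos h3 h2).trans_le h)

theorem numColorings_lt_of_lt {V : Type*} [Fintype V] {H G : SimpleGraph V} (h : H ≤ G) {s t : V}
    (hst : G.Adj s t) {x : ℕ} {c : V → Fin x} (hc : c ∈ H.properColorings x) (hcst : c s = c t) :
    G.numColorings x < H.numColorings x := by
  rw [numColorings_eq_card, numColorings_eq_card]
  refine card_lt_card ⟨fun d hd => mem_properColorings.2 fun v w hvw =>
    mem_properColorings.1 hd v w (h hvw), fun hsub => ?_⟩
  exact mem_properColorings.1 (hsub hc) s t hst hcst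

end SimpleGraph

theorem theorem3 {V : Type*} [Fintype V] (G : SimpleGraph V) (n k : ℕ)
    (hn : Fintype.card V = n) (hk : 4 ≤ k) (hkn : k < n)
    (h2 : G.IsTwoConnected) (hchi : G.chromaticNumber = k) (homega : G.cliqueNum = k)
    (x : ℕ) (hx : k ≤ x) :
    (G.numColorings x : ℤ) ≤
        (descPochhammer ℤ (k - 1)).eval ((x : ℤ) - 1) *
          (((x : ℤ) - 1) ^ (n - k + 1) + (-1) ^ (n - k)) ∧
      ((G.numColorings x : ℤ) =
          (descPochhammer ℤ (k - 1)).eval ((x : ℤ) - 1) *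
            (((x : ℤ) - 1) ^ (n - k + 1) + (-1) ^ (n - k)) ↔
        Nonempty (G ≃g SimpleGraph.cliqueWithEar n k)) := by
  classical
  obtain ⟨K, hKc⟩ := G.exists_isNClique_cliqueNum
  have hKk : #K = k := by rw [hKc.card_eq, homega]
  have hKG : SimpleGraph.completeOn K ≤ G := fun a b h => hKc.isClique h.1 h.2.1 h.2.2
  have hbound := SimpleGraph.pow_mul_bound_eq hn hKk (by omega) hkn hx
  have hpow : (0 : ℤ) < (x : ℤ) ^ (n - k) := pow_pos (by omega) _
  set B : ℤ := (descPochhammer ℤ (k - 1)).eval ((x : ℤ) - 1) *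
    (((x : ℤ) - 1) ^ (n - k + 1) + (-1) ^ (n - k)) with hB
  -- The converse of the equality case: the extremal graph attains the bound.
  have hiso : Nonempty (G ≃g SimpleGraph.cliqueWithEar n k) → (G.numColorings x : ℤ) = B := by
    rintro ⟨φ⟩
    obtain ⟨K', u, hK', hu, hG⟩ := SimpleGraph.exists_isEar_of_iso_cliqueWithEar (by omega) hkn φ
    have h1 := hu.pow_mul_numColorings_completeOn_sup x
    rw [← hG, ← SimpleGraph.pow_mul_bound_eq hn hK' (by omega) hkn hx] at h1
    exact mul_left_cancel₀ hpow.ne' h1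
  have hKuniv : K ≠ univ := by
    rintro rfl
    rw [card_univ] at hKk
    omega
  obtain ⟨u, m, hm, hu, huG⟩ := h2.exists_isEar (S := K) (by omega) hKuniv
  set H := SimpleGraph.completeOn K ⊔ SimpleGraph.seqPath u (m + 1) with hH
  have hHG : H ≤ G := sup_le hKG huG
  by_cases huniv : K ∪ SimpleGraph.internals u m = univ
  · obtain rfl : m = n - k := by
      have h := hu.card_union_internals
      rw [huniv, card_univ] at h
      omega
    have hHB : (H.numColorings x : ℤ) = B := by
      have h1 := hu.pow_mul_numColorings_completeOn_sup x
      rw [← hbound] at h1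
      exact mul_left_cancel₀ hpow.ne' h1
    refine ⟨hHB ▸ (by exact_mod_cast SimpleGraph.numColorings_anti hHG x), fun heq => ?_, hiso⟩
    have hGH : G = H := by
      refine le_antisymm (fun s t hst => ?_) hHG
      by_contra hns
      obtain ⟨c, hc, hcst⟩ := hu.exists_mem_properColorings_eq (x := x) (by omega) (by omega)
        (s := s) (t := t) (huniv ▸ mem_univ s) (huniv ▸ mem_univ t) hst.ne hns
      have hlt := SimpleGraph.numColorings_lt_of_lt hHG hst hc hcst
      zify at hlt
      rw [heq, hHB] at hlt
      exact hlt.false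
    have hiso' := hu.nonempty_iso_cliqueWithEar hm (by omega) huniv
    rwa [← hH, ← hGH, hKk, Nat.add_sub_cancel' hkn.le] at hiso'
  · have hdef : SimpleGraph.IsDeficient G K x univ := by
      obtain ⟨w, l, hl, hw, hwG⟩ := h2.exists_isEar
        (by rw [hu.card_union_internals]; omega) huniv
      exact h2.isDeficient_univ (by omega) (by omega)
        (SimpleGraph.isDeficient_of_two_ears (by omega) hKG hm hu huG hl hw hwG)
    obtain ⟨H', hH'G, -, M, -, hM, hle⟩ := hdef
    obtain rfl : M = n - k := by
      rw [card_univ] at hM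
      omega
    have hpos : (0 : ℤ) < (SimpleGraph.completeOn K).numColorings x := by
      exact_mod_cast SimpleGraph.numColorings_completeOn_pos (by omega) (by omega)
    have hlt : (G.numColorings x : ℤ) < B := by
      refine (Nat.cast_le.2 (SimpleGraph.numColorings_anti hH'G x)).trans_lt ?_
      refine lt_of_mul_lt_mul_left (a := (x : ℤ) ^ (n - k)) ?_ hpow.le
      rw [hbound]
      linarith
    exact ⟨hlt.le, fun h => absurd h hlt.ne, fun h => absurd (hiso h) hlt.ne⟩
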